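/- Let $K,m,N\ge 0$ be integers, $1<p<\infty$, $\lambda>0$ and $y_1,\dots,y_N\in\mathbb R$. Let $W_{m,p}[0,1]$ be the Sobolev space of functions $f$ on $[0,1]$ such that $f,f',\dots,f^{(m-1)}$ are absolutely continuous and $f^{(m)}\in L_p[0,1]$ (so $W_{0,p}=L_p$), with norm $\big(\sum_{j<m}|f^{(j)}(0)|^p+\int_0^1|f^{(m)}|^p\big)^{1/p}$. Let $L_1,\dots,L_N$ be bounded linear functionals on $W_{m,p}[0,1]$, let $\rho_1,\dots,\rho_N:\mathbb R\to\mathbb R$ be continuous and strictly convex, and put $$\mathrm{VP}[f]=\frac{\lambda}{p}\int_0^1|f^{(m)}(s)|^p\,ds+\sum_{i=1}^N\rho_i(L_if-y_i),\qquad f\in W_{m,p}[0,1].$$ For change points $\mathbf x=(x_1,\dots,x_K)$ with $0\le x_1\le\dots\le x_K\le 1$, and with $x_0=0$, $x_{K+1}=1$, let $$V[\mathbf x]=\{f\in W_{m,p}[0,1] : (-1)^{k-1}f^{(m)}(t)\ge 0\ \text{for a.e. } t\in[x_{k-1},x_k],\ k=1,\dots,K+1\}.$$ Then there exist change points $0\le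 \hat x_1\le\dots\le\hat x_K\le 1$ which minimize the variational problem over the choice of change points, that is, $$\inf_{f\in V[\hat{\mathbf x}]}\mathrm{VP}[f]\;\le\;\inf_{f\in V[\mathbf x]}\mathrm{VP}[f]\qquad\text{in }[-\infty,\infty)$$ for all $\mathbf x$ with $0\le x_1\le\dots\le x_K\le1$. If, in addition, the $L_i$ separate polynomials of degree at most $m-1$ (the only polynomial $q$ of degree at most $m-1$ with $L_iq=0$ for all $i$ is $q=0$) and $\rho_i(s)\to\infty$ as $|s|\to\infty$ for each $i$, then moreover there is $\hat f\in V[\hat{\mathbf x}]$ such that $\mathrm{VP}[\hat f]\le\mathrm{VP}[f]$ for every such $\mathbf x$ and every $f\in V[\mathbf x]$. -/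

import Mathlib

open MeasureTheory Set Filter

noncomputable section

namespace PiecewiseConvex

/-- The `j`-th derivative of `f` as a function on `[0,1]` (one-sided at the end points). Only the
values of `f` on `[0,1]` matter for its values on `[0,1]`. -/
def D (j : ℕ) (f : ℝ → ℝ) : ℝ → ℝ := iteratedDerivWithin j f (Icc 0 1)

/-- Lebesgue measure on `[0,1]`. -/
def μ01 : Measure ℝ := volume.restrict (Icc (0 : ℝ) 1)

/-- `f` (more precisely its restriction to `[0,1]`) lies in `W_{m,p}[0,1]`:
`f, f', …, f^{(m-1)}` exist and are absolutely continuous on `[0,1]`, and `f^{(m)} ∈ L_p[0,1]`. -/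
def MemW (m : ℕ) (p : ℝ) (f : ℝ → ℝ) : Prop :=
  (∀ j < m, ContDiffOn ℝ j f (Icc 0 1) ∧ AbsolutelyContinuousOnInterval (D j f) 0 1) ∧
    MemLp (D m f) (ENNReal.ofReal p) μ01

theorem D_zero_fun (j : ℕ) : D j (0 : ℝ → ℝ) = 0 := by
  funext t
  simp [D]

theorem D_smul (j : ℕ) (c : ℝ) (f : ℝ → ℝ) : D j (c • f) = c • D j f := by
  funext t
  simp only [D, Pi.smul_apply]
  exact iteratedDerivWithin_const_smul_field c f

theorem D_add {j : ℕ} {f g : ℝ → ℝ} (hf : ContDiffOn ℝ j f (Icc 0 1))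
    (hg : ContDiffOn ℝ j g (Icc 0 1)) : EqOn (D j (f + g)) (D j f + D j g) (Icc 0 1) := by
  intro t ht
  exact iteratedDerivWithin_add ht (uniqueDiffOn_Icc zero_lt_one) (hf t ht) (hg t ht)

theorem absolutelyContinuousOnInterval_congr {f g : ℝ → ℝ} (h : EqOn f g (Icc 0 1))
    (hf : AbsolutelyContinuousOnInterval f 0 1) : AbsolutelyContinuousOnInterval g 0 1 := by
  rw [absolutelyContinuousOnInterval_iff] at hf ⊢
  intro ε hε
  obtain ⟨δ, hδ, H⟩ := hf ε hε
  refine ⟨δ, hδ, fun E hE hs => ?_⟩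
  have := H E hE hs
  refine lt_of_eq_of_lt (Finset.sum_congr rfl fun i hi => ?_) this
  have h2 := hE.1 i hi
  rw [uIcc_of_le zero_le_one] at h2
  rw [h h2.1, h h2.2]

theorem D_add_ae {m : ℕ} {p : ℝ} {f g : ℝ → ℝ} (hf : MemW m p f) (hg : MemW m p g) :
    D m (f + g) =ᵐ[μ01] D m f + D m g := by
  cases m with
  | zero => exact Eventually.of_forall fun t => by simp [D]
  | succ n =>
    obtain ⟨hf1, hf2⟩ := hf.1 n (Nat.lt_succ_self n)
    obtain ⟨hg1, hg2⟩ := hg.1 n (Nat.lt_succ_self n)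
    have e1 : ∀ᵐ t ∂μ01, t ∈ Icc (0 : ℝ) 1 := ae_restrict_mem measurableSet_Icc
    have e2 : ∀ᵐ t ∂μ01, t ∈ uIcc (0 : ℝ) 1 → DifferentiableAt ℝ (D n f) t :=
      ae_restrict_of_ae hf2.ae_differentiableAt
    have e3 : ∀ᵐ t ∂μ01, t ∈ uIcc (0 : ℝ) 1 → DifferentiableAt ℝ (D n g) t :=
      ae_restrict_of_ae hg2.ae_differentiableAt
    filter_upwards [e1, e2, e3] with t ht hft hgt
    have ht' : t ∈ uIcc (0 : ℝ) 1 := by rwa [uIcc_of_le zero_le_one]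
    have hs : ∀ h : ℝ → ℝ, D (n + 1) h t = derivWithin (D n h) (Icc 0 1) t := fun h => by
      simp only [D, iteratedDerivWithin_succ]
    rw [Pi.add_apply, hs, hs, hs, derivWithin_congr (D_add hf1 hg1) (D_add hf1 hg1 ht)]
    exact derivWithin_add (hft ht').differentiableWithinAt (hgt ht').differentiableWithinAt

/-- The Sobolev space `W_{m,p}[0,1]`, as a space of representatives: two elements which agree on
`[0,1]` are at distance `0` from each other for `normW`. -/
def W (m : ℕ) (p : ℝ) : Submodule ℝ (ℝ → ℝ) where
  carrier := {f | MemW m p f}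
  zero_mem' := by
    refine ⟨fun j _ => ⟨contDiffOn_const, ?_⟩, ?_⟩
    · rw [D_zero_fun]
      exact contDiffOn_const.absolutelyContinuousOnInterval
    · rw [D_zero_fun]
      exact MemLp.zero
  add_mem' := by
    intro f g hf hg
    refine ⟨fun j hj => ⟨(hf.1 j hj).1.add (hg.1 j hj).1, ?_⟩, ?_⟩
    · exact absolutelyContinuousOnInterval_congr (D_add (hf.1 j hj).1 (hg.1 j hj).1).symm
        ((hf.1 j hj).2.add (hg.1 j hj).2)
    · exact (memLp_congr_ae (D_add_ae hf hg)).2 (hf.2.add hg.2)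
  smul_mem' := by
    intro c f hf
    refine ⟨fun j hj => ⟨contDiffOn_const.smul (hf.1 j hj).1, ?_⟩, ?_⟩
    · rw [D_smul]
      exact (hf.1 j hj).2.const_smul c
    · rw [D_smul]
      exact hf.2.const_smul c

/-- The norm `(∑_{j<m} |f^{(j)}(0)|^p + ∫₀¹ |f^{(m)}|^p)^{1/p}` of `W_{m,p}[0,1]`. -/
def normW (m : ℕ) (p : ℝ) (f : ℝ → ℝ) : ℝ :=
  (∑ j ∈ Finset.range m, |D j f 0| ^ p + ∫ t in (0 : ℝ)..1, |D m f t| ^ p) ^ (1 / p)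

/-- The linear functional `L` on `W_{m,p}[0,1]` is bounded. -/
def IsBoundedFunctional {m : ℕ} {p : ℝ} (L : W m p →ₗ[ℝ] ℝ) : Prop :=
  ∃ C : ℝ, ∀ f : W m p, |L f| ≤ C * normW m p f

/-- Smooth functions, in particular polynomials, belong to `W_{m,p}[0,1]`. -/
theorem polynomial_mem_W (m : ℕ) (p : ℝ) (q : Polynomial ℝ) : (fun t => q.eval t) ∈ W m p := by
  have hq : ∀ n : ℕ, ContDiffOn ℝ n (fun t => q.eval t) (Icc (0 : ℝ) 1) := fun n => by
    simpa using (Polynomial.contDiff_aeval (𝕜 := ℝ) q (n : WithTop ℕ∞)).contDiffOn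
  have hd : ∀ j : ℕ, ContDiffOn ℝ 1 (D j fun t => q.eval t) (Icc (0 : ℝ) 1) := fun j => by
    have := hq (j + 1)
    exact ((contDiffOn_nat_succ_iff_contDiffOn_one_iteratedDerivWithin
      (uniqueDiffOn_Icc zero_lt_one)).1 (by exact_mod_cast this)).2
  refine ⟨fun j _ => ⟨hq j, ?_⟩, ?_⟩
  · apply ContDiffOn.absolutelyContinuousOnInterval
    rw [uIcc_of_le zero_le_one]
    exact hd j
  · have hc := (hd m).continuousOn
    obtain ⟨C, hC⟩ := isCompact_Icc.exists_bound_of_continuousOn hc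
    have : IsFiniteMeasure μ01 := by unfold μ01; infer_instance
    refine MemLp.of_bound (hc.aestronglyMeasurable measurableSet_Icc) C ?_
    exact (ae_restrict_iff' measurableSet_Icc).2 (Eventually.of_forall hC)

/-- The functionals `L_i` separate the polynomials of degree at most `m - 1`. -/
def SeparatesPolynomials {N m : ℕ} {p : ℝ} (L : Fin N → W m p →ₗ[ℝ] ℝ) : Prop :=
  ∀ q : Polynomial ℝ, q.degree < m →
    (∀ i, L i ⟨fun t => q.eval t, polynomial_mem_W m p q⟩ = 0) → q = 0

/-- The admissible change point vectors `0 ≤ x_1 ≤ x_2 ≤ … ≤ x_K ≤ 1`. -/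
def ChangePoints (K : ℕ) : Set (Fin K → ℝ) := {x | Monotone x ∧ ∀ k, x k ∈ Icc (0 : ℝ) 1}

/-- The knots `x_0 = 0, x_1, …, x_K, x_{K+1} = 1`. -/
def knot {K : ℕ} (x : Fin K → ℝ) : Fin (K + 2) → ℝ :=
  Fin.snoc (α := fun _ => ℝ) (Fin.cons (α := fun _ => ℝ) 0 x) 1

/-- The cone of the `f ∈ W_{m,p}[0,1]` for which
`(-1)^{k-1} f^{(m)}(t) ≥ 0` for almost every `t ∈ [x_{k-1}, x_k]`, `k = 1, …, K+1`
(the index `k : Fin (K + 1)` below is `k - 1` here). -/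
def V (m : ℕ) (p : ℝ) {K : ℕ} (x : Fin K → ℝ) : Set (W m p) :=
  {f | ∀ k : Fin (K + 1), ∀ᵐ t ∂volume,
    t ∈ Icc (knot x k.castSucc) (knot x k.succ) → 0 ≤ (-1 : ℝ) ^ (k : ℕ) * D m f t}

/-- The penalized likelihood `VP[f] = (λ/p) ∫₀¹ |f^{(m)}|^p + ∑_i ρ_i(L_i f - y_i)`. -/
def VP {N m : ℕ} {p : ℝ} (lam : ℝ) (ρ : Fin N → ℝ → ℝ) (L : Fin N → W m p →ₗ[ℝ] ℝ)
    (y : Fin N → ℝ) (f : W m p) : ℝ :=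
  lam / p * (∫ t in (0 : ℝ)..1, |D m f t| ^ p) + ∑ i, ρ i (L i f - y i)

/-- The value, in the extended reals, of the variational problem with change points `x`:
`inf {VP[f] | f ∈ V[x]}`. -/
def optimalValue {N m : ℕ} {p : ℝ} (lam : ℝ) (ρ : Fin N → ℝ → ℝ) (L : Fin N → W m p →ₗ[ℝ] ℝ)
    (y : Fin N → ℝ) {K : ℕ} (x : Fin K → ℝ) : EReal :=
  ⨅ f ∈ V m p x, (VP lam ρ L y f : EReal)

end PiecewiseConvex

end

noncomputable section

namespace PiecewiseConvex

open scoped Topology ENNReal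

/-! Up to a function that bounded functionals cannot see, `f` is a polynomial of degree less than
`m` plus an `m`-fold primitive of `g = f^{(m)}`. The sign conditions and the penalty involve only
`g`, while the polynomial moves the observation vector `A g` freely within a subspace `U` of `ℝ^N`.
Eliminating it replaces the data fit `F` by `Φ u = inf_{w ∈ U} F (u + w)`. Either `F` is unbounded
below on `U`, and `g = 0` already gives the value `-∞` for any change points, or `Φ` is finite
everywhere and convex, and `(λ/p) ‖g‖^p + Φ (A g)` has to be minimized over the union of the sign
cones in `L_p` (`exists_minimizer_signCone`).

That union is not convex. Along a minimizing sequence a subsequence of the change points converges,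
by compactness, to some `x`. Each `g_n` is set to zero where its sign pattern may disagree with that
of `x`. This puts it in the cone of `x` and does not increase its norm; the observations change by
`o(1)`, because a bounded functional is small on bounded functions with small support
(`tendsto_apply_of_small_support`). The modified sequence still minimizes, now in one closed convex
cone, so uniform convexity of the norm makes it Cauchy (`cauchySeq_of_minimizing`), and its limit is
a minimizer. No weak compactness or duality is needed.

If the `ρ_i` are coercive, the infimum defining `Φ` is attained, which yields `f`. -/

/-! ### Scalar inequalities for `|t|^p`. -/

theorem exists_linear_le_rpow {p c : ℝ} (hp : 1 < p) (hc : 0 < c) {a : ℝ} (ha : 0 ≤ a) :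
    ∃ B, ∀ s : ℝ, 0 ≤ s → a * s ≤ c * s ^ p + B := by
  obtain ⟨R, hR⟩ := (tendsto_atTop_atTop.1 (tendsto_rpow_atTop (sub_pos.2 hp))) (a / c)
  refine ⟨a * max R 1, fun s hs => ?_⟩
  rcases le_total s (max R 1) with h | h
  · have := mul_le_mul_of_nonneg_left h ha
    have : 0 ≤ c * s ^ p := by positivity
    linarith
  · have hs1 : 0 < s := lt_of_lt_of_le one_pos ((le_max_right _ _).trans h)
    have h1 := hR s ((le_max_left _ _).trans h)
    rw [div_le_iff₀ hc] at h1
    have h2 : s ^ p = s ^ (p - 1) * s := by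
      rw [← Real.rpow_add_one hs1.ne']; congr 1; ring
    have h3 := mul_le_mul_of_nonneg_right h1 hs
    have : 0 ≤ a * max R 1 := mul_nonneg ha (by positivity)
    rw [h2]; nlinarith

theorem abs_half_add_rpow_le {p : ℝ} (hp : 1 < p) (a b : ℝ) :
    |(a + b) / 2| ^ p ≤ (|a| ^ p + |b| ^ p) / 2 := by
  have h := (convexOn_rpow hp.le).2 (mem_Ici.2 (abs_nonneg a)) (mem_Ici.2 (abs_nonneg b))
    (by norm_num : (0 : ℝ) ≤ 1 / 2) (by norm_num : (0 : ℝ) ≤ 1 / 2) (by norm_num)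
  simp only [smul_eq_mul] at h
  have h1 : |(a + b) / 2| ≤ 1 / 2 * |a| + 1 / 2 * |b| := by
    rw [abs_div, abs_two]; linarith [abs_add_le a b]
  have := Real.rpow_le_rpow (abs_nonneg _) h1 (by linarith : 0 ≤ p)
  linarith

/-- Strict convexity of `s ↦ s^p` on `[0, ∞)` only separates different absolute values; in the
remaining case `a = -b` the midpoint is `0`. -/
theorem abs_half_add_rpow_lt {p : ℝ} (hp : 1 < p) {a b : ℝ} (hab : a ≠ b) :
    |(a + b) / 2| ^ p < (|a| ^ p + |b| ^ p) / 2 := by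
  by_cases h0 : |a| = |b|
  · rcases abs_eq_abs.1 h0 with h | h
    · exact absurd h hab
    · have hb : b ≠ 0 := by rintro rfl; simp at h; exact hab h
      subst h
      simp only [neg_add_cancel, zero_div, abs_zero, abs_neg]
      rw [Real.zero_rpow (by linarith)]
      have : 0 < |b| := abs_pos.2 hb
      positivity
  · have h := (strictConvexOn_rpow hp).2 (mem_Ici.2 (abs_nonneg a)) (mem_Ici.2 (abs_nonneg b)) h0
      (by norm_num : (0 : ℝ) < 1 / 2) (by norm_num : (0 : ℝ) < 1 / 2) (by norm_num)
    simp only [smul_eq_mul] at h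
    have h1 : |(a + b) / 2| ≤ 1 / 2 * |a| + 1 / 2 * |b| := by
      rw [abs_div, abs_two]; linarith [abs_add_le a b]
    have := Real.rpow_le_rpow (abs_nonneg _) h1 (by linarith : 0 ≤ p)
    linarith

/-- Uniform convexity of `t ↦ |t|^p`, in a form which can be integrated. -/
theorem exists_abs_sub_rpow_le {p : ℝ} (hp : 1 < p) {ε : ℝ} (hε : 0 < ε) :
    ∃ C, 0 ≤ C ∧ ∀ a b : ℝ, |a - b| ^ p ≤
      ε * (|a| ^ p + |b| ^ p) + C * ((|a| ^ p + |b| ^ p) / 2 - |(a + b) / 2| ^ p) := by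
  have p0 : 0 ≤ p := by linarith
  let d : ℝ × ℝ → ℝ := fun z => (|z.1| ^ p + |z.2| ^ p) / 2 - |(z.1 + z.2) / 2| ^ p
  have hc : ∀ u : ℝ × ℝ → ℝ, Continuous u → Continuous fun z => |u z| ^ p := fun u hu =>
    (Real.continuous_rpow_const p0).comp hu.abs
  have hd : Continuous d := by
    have h1 := hc Prod.fst continuous_fst
    have h2 := hc Prod.snd continuous_snd
    have h3 := hc (fun z => (z.1 + z.2) / 2) (by fun_prop)
    exact ((h1.add h2).div_const 2).sub h3
  -- All terms are homogeneous of degree `p`, so the unit sphere suffices. On this compact part of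
  -- it, away from the diagonal, the midpoint deficit `d` has a positive minimum; elsewhere the `ε`
  -- term alone is enough.
  let K : Set (ℝ × ℝ) := Metric.sphere 0 1 ∩ {z | ε ≤ |z.1 - z.2| ^ p}
  have hK : IsCompact K := (isCompact_sphere 0 1).inter_right
    (isClosed_le continuous_const (hc (fun z => z.1 - z.2) (by fun_prop)))
  have hnorm : ∀ z : ℝ × ℝ, ‖z‖ = 1 → |z.1 - z.2| ^ p ≤ 2 ^ p := fun z hz => by
    have h1 := norm_fst_le z
    have h2 := norm_snd_le z
    rw [hz, Real.norm_eq_abs] at h1 h2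
    exact Real.rpow_le_rpow (abs_nonneg _) ((abs_sub z.1 z.2).trans (by linarith)) p0
  have hone : ∀ z : ℝ × ℝ, ‖z‖ = 1 → 1 ≤ |z.1| ^ p + |z.2| ^ p := fun z hz => by
    have n1 : 0 ≤ |z.1| ^ p := by positivity
    have n2 : 0 ≤ |z.2| ^ p := by positivity
    rw [Prod.norm_def, Real.norm_eq_abs, Real.norm_eq_abs] at hz
    rcases max_choice |z.1| |z.2| with h | h
    · rw [hz] at h; rw [← h, Real.one_rpow]; linarith
    · rw [hz] at h; rw [← h, Real.one_rpow]; linarith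
  have key : ∃ C, 0 ≤ C ∧ ∀ z : ℝ × ℝ, ‖z‖ = 1 → |z.1 - z.2| ^ p ≤
      ε * (|z.1| ^ p + |z.2| ^ p) + C * d z := by
    have hd0 : ∀ z, 0 ≤ d z := fun z => sub_nonneg.2 (abs_half_add_rpow_le hp z.1 z.2)
    rcases K.eq_empty_or_nonempty with hemp | hne
    · refine ⟨0, le_rfl, fun z hz => ?_⟩
      have : ¬ ε ≤ |z.1 - z.2| ^ p := fun h => by
        have : z ∈ K := ⟨by simpa using hz, h⟩
        simp [hemp] at this
      have := hone z hz
      nlinarith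
    · obtain ⟨w, hw, hmin⟩ := hK.exists_isMinOn hne hd.continuousOn
      have hdw : 0 < d w := by
        refine sub_pos.2 (abs_half_add_rpow_lt hp fun h => ?_)
        have := hw.2
        simp only [mem_ofPred_eq, h, sub_self, abs_zero] at this
        rw [Real.zero_rpow (by linarith)] at this
        linarith
      refine ⟨2 ^ p / d w, by positivity, fun z hz => ?_⟩
      have h1 := hone z hz
      by_cases h : ε ≤ |z.1 - z.2| ^ p
      · have h2 : d w ≤ d z := hmin ⟨by simpa using hz, h⟩
        have h3 : 2 ^ p ≤ 2 ^ p / d w * d z := by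
          rw [div_mul_eq_mul_div, le_div_iff₀ hdw]
          exact mul_le_mul_of_nonneg_left h2 (by positivity)
        have := hnorm z hz
        have : 0 ≤ ε * (|z.1| ^ p + |z.2| ^ p) := by positivity
        linarith
      · have : 0 ≤ 2 ^ p / d w * d z := mul_nonneg (by positivity) (hd0 z)
        nlinarith
  obtain ⟨C, hC0, hC⟩ := key
  refine ⟨C, hC0, fun a b => ?_⟩
  by_cases h0 : ((a, b) : ℝ × ℝ) = 0
  · obtain ⟨rfl, rfl⟩ := Prod.mk.inj h0
    simp [Real.zero_rpow (by linarith : p ≠ 0)]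
  have hr : 0 < ‖((a, b) : ℝ × ℝ)‖ := norm_pos_iff.2 h0
  obtain ⟨r, hr', z, hz, ha, hb⟩ : ∃ r : ℝ, 0 < r ∧ ∃ z : ℝ × ℝ, ‖z‖ = 1 ∧ a = r * z.1 ∧
      b = r * z.2 := by
    refine ⟨_, hr, ‖((a, b) : ℝ × ℝ)‖⁻¹ • (a, b), norm_smul_inv_norm h0, ?_, ?_⟩
    · simp only [Prod.smul_fst, smul_eq_mul]; field_simp
    · simp only [Prod.smul_snd, smul_eq_mul]; field_simp
  have hs : ∀ t : ℝ, |r * t| ^ p = r ^ p * |t| ^ p := fun t => by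
    rw [abs_mul, abs_of_pos hr', Real.mul_rpow hr'.le (abs_nonneg _)]
  have h := mul_le_mul_of_nonneg_left (hC z hz) (by positivity : 0 ≤ r ^ p)
  have e1 : a - b = r * (z.1 - z.2) := by rw [ha, hb]; ring
  have e2 : (a + b) / 2 = r * ((z.1 + z.2) / 2) := by rw [ha, hb]; ring
  rw [e1, e2, hs, hs, ha, hb, hs, hs]
  calc _ ≤ _ := h
    _ = _ := by simp only [d]; ring

/-! ### Uniform convexity and bounded functionals in `L_p`. -/

section Lp

variable {α : Type*} [MeasurableSpace α] {μ : Measure α} {p : ℝ}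

theorem integrable_abs_rpow (hp : 1 < p) {g : α → ℝ} (hg : MemLp g (ENNReal.ofReal p) μ) :
    Integrable (fun t => |g t| ^ p) μ := by
  have := hg.integrable_norm_rpow (by simpa using (by linarith : 0 < p)) ENNReal.ofReal_ne_top
  simpa [ENNReal.toReal_ofReal (by linarith : 0 ≤ p)] using this

theorem norm_Lp_rpow (hp : 1 < p) (g : Lp ℝ (ENNReal.ofReal p) μ) :
    ‖g‖ ^ p = ∫ t, |g t| ^ p ∂μ := by
  have p0 : 0 < p := by linarith
  rw [Lp.norm_def, (Lp.memLp g).eLpNorm_eq_integral_rpow_norm (by simpa using p0)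
    ENNReal.ofReal_ne_top, ENNReal.toReal_ofReal p0.le, ENNReal.toReal_ofReal]
  · rw [← Real.rpow_mul, inv_mul_cancel₀ p0.ne', Real.rpow_one]
    · rfl
    · exact integral_nonneg fun t => by positivity
  · exact Real.rpow_nonneg (integral_nonneg fun t => by positivity) _

/-- The scalar inequality is linear in the `p`-th powers, so it integrates term by term. -/
theorem exists_norm_sub_rpow_le (hp : 1 < p) {ε : ℝ} (hε : 0 < ε) :
    ∃ C, 0 ≤ C ∧ ∀ g h : Lp ℝ (ENNReal.ofReal p) μ, ‖g - h‖ ^ p ≤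
      ε * (‖g‖ ^ p + ‖h‖ ^ p) +
        C * ((‖g‖ ^ p + ‖h‖ ^ p) / 2 - ‖(1 / 2 : ℝ) • (g + h)‖ ^ p) := by
  obtain ⟨C, hC0, hC⟩ := exists_abs_sub_rpow_le hp hε
  refine ⟨C, hC0, fun g h => ?_⟩
  have i : ∀ u : Lp ℝ (ENNReal.ofReal p) μ, Integrable (fun t => |u t| ^ p) μ := fun u =>
    integrable_abs_rpow hp (Lp.memLp u)
  have i1 : Integrable (fun t => |g t| ^ p + |h t| ^ p) μ := (i g).add (i h)
  have i2 : Integrable (fun t => (|g t| ^ p + |h t| ^ p) / 2) μ := i1.div_const 2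
  have i3 : Integrable (fun t => (|g t| ^ p + |h t| ^ p) / 2 -
      |((1 / 2 : ℝ) • (g + h) : Lp ℝ (ENNReal.ofReal p) μ) t| ^ p) μ := i2.sub (i _)
  simp only [norm_Lp_rpow hp]
  rw [← integral_add (i g) (i h), ← integral_const_mul, ← integral_div, ← integral_sub i2 (i _),
    ← integral_const_mul, ← integral_add (i1.const_mul ε) (i3.const_mul C)]
  refine integral_mono_ae (i _) ((i1.const_mul ε).add (i3.const_mul C)) ?_
  filter_upwards [Lp.coeFn_sub g h, Lp.coeFn_smul (1 / 2 : ℝ) (g + h), Lp.coeFn_add g h]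
    with t h1 h2 h3
  have e : (1 / 2 : ℝ) * (g t + h t) = (g t + h t) / 2 := by ring
  simp only [h1, h2, h3, Pi.sub_apply, Pi.smul_apply, Pi.add_apply, smul_eq_mul, e]
  exact hC (g t) (h t)

variable [Fact (1 ≤ ENNReal.ofReal p)]

/-- Minimizing sequences of a strictly convex functional `c ‖g‖^p + Ψ g` in a midpoint convex set
are Cauchy sequences. -/
theorem cauchySeq_of_minimizing (hp : 1 < p) {c : ℝ} (hc : 0 < c)
    {Ψ : Lp ℝ (ENNReal.ofReal p) μ → ℝ}
    (hΨ : ∀ g h, Ψ ((1 / 2 : ℝ) • (g + h)) ≤ (Ψ g + Ψ h) / 2)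
    {S : Set (Lp ℝ (ENNReal.ofReal p) μ)} (hS : ∀ g ∈ S, ∀ h ∈ S, (1 / 2 : ℝ) • (g + h) ∈ S)
    {j : ℝ} (hj : ∀ g ∈ S, j ≤ c * ‖g‖ ^ p + Ψ g) {g : ℕ → Lp ℝ (ENNReal.ofReal p) μ}
    (hg : ∀ n, g n ∈ S) {M : ℝ} (hM : ∀ n, ‖g n‖ ≤ M)
    (hlim : Tendsto (fun n => c * ‖g n‖ ^ p + Ψ (g n)) atTop (𝓝 j)) : CauchySeq g := by
  have p0 : 0 < p := by linarith
  rw [Metric.cauchySeq_iff']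
  intro η hη
  have hM0 : 0 ≤ M := (norm_nonneg _).trans (hM 0)
  -- With this `ε` the first error is at most `η^p / 2`. The tolerance `c η^p / (4 (C + 1))` below
  -- keeps the second at most `η^p / 4`, because the midpoint stays in `S` and has value at least
  -- `j`. Together they stay below `η^p`.
  obtain ⟨C, hC0, hC⟩ := exists_norm_sub_rpow_le (μ := μ) hp
    (ε := η ^ p / (4 * (M ^ p + 1))) (by positivity)
  have hδ : 0 < c * η ^ p / (4 * (C + 1)) := by positivity
  obtain ⟨n₀, hn₀⟩ := eventually_atTop.1 (hlim.eventually (gt_mem_nhds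
    (lt_add_of_pos_right j hδ)))
  refine ⟨n₀, fun n hn => ?_⟩
  rw [dist_eq_norm]
  by_contra! hcon
  have hpow : η ^ p ≤ ‖g n - g n₀‖ ^ p := Real.rpow_le_rpow hη.le hcon p0.le
  have h1 := hC (g n) (g n₀)
  have h2 := hn₀ n hn
  have h3 := hn₀ n₀ le_rfl
  have h4 := hj _ (hS _ (hg n) _ (hg n₀))
  have h5 := hΨ (g n) (g n₀)
  have m1 : ‖g n‖ ^ p ≤ M ^ p := Real.rpow_le_rpow (norm_nonneg _) (hM n) p0.le
  have m2 : ‖g n₀‖ ^ p ≤ M ^ p := Real.rpow_le_rpow (norm_nonneg _) (hM n₀) p0.le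
  set Δ := (‖g n‖ ^ p + ‖g n₀‖ ^ p) / 2 - ‖(1 / 2 : ℝ) • (g n + g n₀)‖ ^ p with hΔ
  have hcΔ : c * Δ < c * η ^ p / (4 * (C + 1)) := by
    have : c * Δ = (c * ‖g n‖ ^ p + c * ‖g n₀‖ ^ p) / 2
      - c * ‖(1 / 2 : ℝ) • (g n + g n₀)‖ ^ p := by rw [hΔ]; ring
    linarith
  have hΔ' : Δ < η ^ p / (4 * (C + 1)) := by
    rw [mul_div_assoc] at hcΔ
    exact lt_of_mul_lt_mul_left hcΔ hc.le
  have a1 : η ^ p / (4 * (M ^ p + 1)) * (‖g n‖ ^ p + ‖g n₀‖ ^ p) ≤ η ^ p / 2 := by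
    have hMp : 0 ≤ M ^ p := by positivity
    calc _ ≤ η ^ p / (4 * (M ^ p + 1)) * (2 * (M ^ p + 1)) :=
          mul_le_mul_of_nonneg_left (by linarith) (by positivity)
      _ = η ^ p / 2 := by field_simp; norm_num
  have a2 : C * Δ ≤ η ^ p / 4 := by
    calc C * Δ ≤ C * (η ^ p / (4 * (C + 1))) := mul_le_mul_of_nonneg_left hΔ'.le hC0
      _ ≤ (C + 1) * (η ^ p / (4 * (C + 1))) :=
        mul_le_mul_of_nonneg_right (by linarith) (by positivity)
      _ = η ^ p / 4 := by field_simp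
  have : 0 < η ^ p := by positivity
  linarith

theorem add_rpow_le_two_rpow {p : ℝ} (hp : 1 < p) (a b : ℝ) :
    |a + b| ^ p ≤ 2 ^ p * (|a| ^ p + |b| ^ p) := by
  have h := abs_half_add_rpow_le hp a b
  rw [abs_div, abs_two, Real.div_rpow (abs_nonneg _) zero_le_two,
    div_le_iff₀ (by positivity)] at h
  have : 0 ≤ (|a| ^ p + |b| ^ p) * 2 ^ p := by positivity
  linarith

/-- A bounded linear functional on `L^p` is small on bounded functions with small support. -/
theorem eventually_apply_lt_of_small_support (hp : 1 < p)
    (A : Lp ℝ (ENNReal.ofReal p) μ →L[ℝ] ℝ) {ι : Type*} {l : Filter ι} {E : ι → Set α}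
    (hE : ∀ i, MeasurableSet (E i)) (hμE : Tendsto (fun i => μ (E i)) l (𝓝 0))
    {h : ι → Lp ℝ (ENNReal.ofReal p) μ} (hsupp : ∀ i, ∀ᵐ t ∂μ, t ∉ E i → h i t = 0) {M : ℝ}
    (hM : ∀ i, ‖h i‖ ≤ M) {ε : ℝ} (hε : 0 < ε) : ∀ᶠ i in l, A (h i) < ε := by
  have p0 : 0 < p := by linarith
  -- A near-minimizer `g` of `I` stands in for the function representing `A`: comparing `I g` with
  -- `I (g + t • h i)` bounds `t * A (h i)` by three errors of size `t ε / 3`.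
  let I : Lp ℝ (ENNReal.ofReal p) μ → ℝ := fun g => ‖g‖ ^ p - A g
  obtain ⟨B, hB⟩ := exists_linear_le_rpow hp one_pos (norm_nonneg A)
  have hbdd : BddBelow (range I) := by
    refine ⟨-B, ?_⟩
    rintro _ ⟨g, rfl⟩
    have h1 := hB ‖g‖ (norm_nonneg g)
    have h2 := (le_abs_self _).trans (A.le_opNorm g)
    simp only [I]; linarith
  have hMp : 0 < max M 1 := by positivity
  -- The order of choices matters: `t` first, using `t^p = o(t)`; then `g`, with accuracy depending
  -- on `t`; then `i`, so late that `g` has little mass on `E i`.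
  obtain ⟨t, ht, htM⟩ : ∃ t : ℝ, 0 < t ∧ 2 ^ p * ((max M 1) ^ p * t ^ (p - 1)) < ε / 3 := by
    have h0 : Tendsto (fun t : ℝ => 2 ^ p * ((max M 1) ^ p * t ^ (p - 1))) (𝓝[>] 0) (𝓝 0) := by
      have := (Real.continuous_rpow_const (sub_pos.2 hp).le).tendsto (0 : ℝ)
      rw [Real.zero_rpow (sub_pos.2 hp).ne'] at this
      simpa using ((this.const_mul ((max M 1) ^ p)).const_mul (2 ^ p)).mono_left
        nhdsWithin_le_nhds
    obtain ⟨t, h1, h2⟩ := ((h0.eventually (gt_mem_nhds (by positivity : 0 < ε / 3))).and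
      self_mem_nhdsWithin).exists
    exact ⟨t, h2, h1⟩
  obtain ⟨_, ⟨g, rfl⟩, hg⟩ := exists_lt_of_csInf_lt (range_nonempty I)
    (lt_add_of_pos_right (sInf (range I)) (by positivity : 0 < t * (ε / 3)))
  have hgi := integrable_abs_rpow hp (Lp.memLp g)
  have hsmall := (hgi.tendsto_setIntegral_nhds_zero hμE).eventually
    (gt_mem_nhds (by positivity : (0 : ℝ) < t * (ε / 3) / 2 ^ p))
  filter_upwards [hsmall] with i hi
  have hmin := csInf_le hbdd (mem_range_self (f := I) (g + t • h i))
  have hpert : ‖g + t • h i‖ ^ p ≤ ‖g‖ ^ p +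
      2 ^ p * (∫ s in E i, |g s| ^ p ∂μ) + 2 ^ p * (t ^ p * ‖h i‖ ^ p) := by
    have ih := integrable_abs_rpow hp (Lp.memLp (h i))
    have i1 : Integrable (fun s => 2 ^ p * (E i).indicator (fun s => |g s| ^ p) s) μ :=
      (hgi.indicator (hE i)).const_mul _
    have i2 : Integrable (fun s => |g s| ^ p +
      2 ^ p * (E i).indicator (fun s => |g s| ^ p) s) μ := hgi.add i1
    have i3 : Integrable (fun s => 2 ^ p * (t ^ p * |h i s| ^ p)) μ :=
      (ih.const_mul _).const_mul _
    rw [norm_Lp_rpow hp, norm_Lp_rpow hp, norm_Lp_rpow hp, ← integral_indicator (hE i),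
      ← integral_const_mul, ← integral_const_mul, ← integral_const_mul,
      ← integral_add hgi i1, ← integral_add i2 i3]
    refine integral_mono_ae (integrable_abs_rpow hp (Lp.memLp _)) (i2.add i3) ?_
    filter_upwards [Lp.coeFn_add g (t • h i), Lp.coeFn_smul t (h i), hsupp i] with s h1 h2 h3
    simp only [h1, h2, Pi.add_apply, Pi.smul_apply, smul_eq_mul]
    by_cases hs : s ∈ E i
    · rw [indicator_of_mem hs]
      have := add_rpow_le_two_rpow hp (g s) (t * h i s)
      rw [abs_mul, abs_of_pos ht, Real.mul_rpow ht.le (abs_nonneg _)] at this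
      have : 0 ≤ |g s| ^ p := by positivity
      linarith
    · simp [h3 hs, indicator_of_notMem hs, Real.zero_rpow p0.ne']
  have hnM : ‖h i‖ ^ p ≤ (max M 1) ^ p :=
    Real.rpow_le_rpow (norm_nonneg _) ((hM i).trans (le_max_left _ _)) p0.le
  have htp : t ^ p = t * t ^ (p - 1) := by
    rw [mul_comm, ← Real.rpow_add_one ht.ne']; congr 1; ring
  have b1 : 2 ^ p * (t ^ p * ‖h i‖ ^ p) < t * (ε / 3) := by
    calc 2 ^ p * (t ^ p * ‖h i‖ ^ p) ≤ 2 ^ p * (t ^ p * (max M 1) ^ p) := by gcongr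
      _ = t * (2 ^ p * ((max M 1) ^ p * t ^ (p - 1))) := by rw [htp]; ring
      _ < t * (ε / 3) := mul_lt_mul_of_pos_left htM ht
  have b2 : 2 ^ p * (∫ s in E i, |g s| ^ p ∂μ) < t * (ε / 3) := by
    rw [lt_div_iff₀ (by positivity)] at hi
    linarith
  simp only [I, map_add, map_smul, smul_eq_mul] at hmin hg
  have : t * A (h i) < t * ε := by linarith
  exact lt_of_mul_lt_mul_left this ht.le

theorem tendsto_apply_of_small_support (hp : 1 < p)
    (A : Lp ℝ (ENNReal.ofReal p) μ →L[ℝ] ℝ) {ι : Type*} {l : Filter ι} {E : ι → Set α}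
    (hE : ∀ i, MeasurableSet (E i)) (hμE : Tendsto (fun i => μ (E i)) l (𝓝 0))
    {h : ι → Lp ℝ (ENNReal.ofReal p) μ} (hsupp : ∀ i, ∀ᵐ t ∂μ, t ∉ E i → h i t = 0) {M : ℝ}
    (hM : ∀ i, ‖h i‖ ≤ M) : Tendsto (fun i => A (h i)) l (𝓝 0) := by
  rw [Metric.tendsto_nhds]
  intro ε hε
  filter_upwards [eventually_apply_lt_of_small_support hp A hE hμE hsupp hM hε,
    eventually_apply_lt_of_small_support hp (-A) hE hμE hsupp hM hε] with i h1 h2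
  rw [dist_zero_right, Real.norm_eq_abs, abs_lt]
  simp only [_root_.neg_apply] at h2
  exact ⟨by linarith, h1⟩

end Lp

/-! ### Change points, sign cones and the minimization in `L_p`. -/

section

theorem isCompact_changePoints (K : ℕ) : IsCompact (ChangePoints K) := by
  have h : ChangePoints K = {x | Monotone x} ∩ univ.pi fun _ => Icc (0 : ℝ) 1 := by
    ext x; simp only [ChangePoints, mem_ofPred_eq, mem_inter_iff, mem_univ_pi]
  rw [h]
  exact (isCompact_univ_pi fun _ => isCompact_Icc).inter_left isClosed_monotone

theorem continuous_knot {K : ℕ} (k : Fin (K + 2)) :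
    Continuous fun x : Fin K → ℝ => knot x k := by
  unfold knot
  refine Fin.lastCases ?_ (fun i => ?_) k
  · simpa using continuous_const
  · simp only [Fin.snoc_castSucc]
    refine Fin.cases ?_ (fun i => ?_) i
    · simpa using continuous_const
    · simpa using continuous_apply i

theorem knot_mem_Icc {K : ℕ} {x : Fin K → ℝ} (hx : x ∈ ChangePoints K) (k : Fin (K + 2)) :
    knot x k ∈ Icc (0 : ℝ) 1 := by
  unfold knot
  refine Fin.lastCases ?_ (fun i => ?_) k
  · simp
  · simp only [Fin.snoc_castSucc]
    refine Fin.cases ?_ (fun i => ?_) i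
    · simp
    · simpa using hx.2 i

/-- The set of points which lie in the `k`-th interval for `x`, but not in the one for `x'`. -/
def mismatch {K : ℕ} (x x' : Fin K → ℝ) : Set ℝ :=
  ⋃ k : Fin (K + 1), Icc (knot x k.castSucc) (knot x k.succ) \
    Icc (knot x' k.castSucc) (knot x' k.succ)

theorem measurableSet_mismatch {K : ℕ} (x x' : Fin K → ℝ) : MeasurableSet (mismatch x x') :=
  MeasurableSet.iUnion fun _ => measurableSet_Icc.diff measurableSet_Icc

theorem volume_Icc_diff_Icc_le (a b a' b' : ℝ) :
    volume (Icc a b \ Icc a' b') ≤ ENNReal.ofReal (a' - a) + ENNReal.ofReal (b - b') := by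
  have : Icc a b \ Icc a' b' ⊆ Ico a a' ∪ Ioc b' b := by
    rintro t ⟨⟨h1, h2⟩, h3⟩
    by_cases h : a' ≤ t
    · exact Or.inr ⟨lt_of_not_ge fun h' => h3 ⟨h, h'⟩, h2⟩
    · exact Or.inl ⟨h1, lt_of_not_ge h⟩
  calc _ ≤ _ := measure_mono this
    _ ≤ _ := measure_union_le _ _
    _ = _ := by rw [Real.volume_Ico, Real.volume_Ioc]

/-- The knots depend continuously on the change points, and each difference of intervals is no
longer than the total inward shift of its end points. -/
theorem tendsto_measure_mismatch {K : ℕ} {ι : Type*} {l : Filter ι} {x : Fin K → ℝ}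
    {u : ι → Fin K → ℝ} (hu : Tendsto u l (𝓝 x)) :
    Tendsto (fun i => μ01 (mismatch x (u i))) l (𝓝 0) := by
  have hb : ∀ i, μ01 (mismatch x (u i)) ≤ ∑ k : Fin (K + 1),
      (ENNReal.ofReal (knot (u i) k.castSucc - knot x k.castSucc) +
        ENNReal.ofReal (knot x k.succ - knot (u i) k.succ)) := fun i => by
    calc _ ≤ volume (mismatch x (u i)) := Measure.restrict_apply_le _ _
      _ ≤ ∑ k : Fin (K + 1), volume (Icc (knot x k.castSucc) (knot x k.succ) \
          Icc (knot (u i) k.castSucc) (knot (u i) k.succ)) := measure_iUnion_fintype_le _ _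
      _ ≤ _ := Finset.sum_le_sum fun k _ => volume_Icc_diff_Icc_le _ _ _ _
  refine tendsto_of_tendsto_of_tendsto_of_le_of_le tendsto_const_nhds ?_ (fun _ => zero_le) hb
  have hk : ∀ k, Tendsto (fun i => knot (u i) k) l (𝓝 (knot x k)) := fun k =>
    ((continuous_knot k).tendsto x).comp hu
  have : (0 : ℝ≥0∞) = ∑ k : Fin (K + 1), (ENNReal.ofReal (knot x k.castSucc - knot x k.castSucc) +
      ENNReal.ofReal (knot x k.succ - knot x k.succ)) := by simp
  rw [this]
  exact tendsto_finsetSum _ fun k _ =>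
    (ENNReal.tendsto_ofReal ((hk _).sub tendsto_const_nhds)).add
      (ENNReal.tendsto_ofReal (tendsto_const_nhds.sub (hk _)))

/-- The origin lies between `u` and a point of the unit ball opposite to it. Since `Φ` is bounded
above on the ball, convexity prevents `Φ u` from falling faster than linearly. -/
theorem exists_affine_le_of_convexOn {E : Type*} [NormedAddCommGroup E] [NormedSpace ℝ E]
    [FiniteDimensional ℝ E] {Φ : E → ℝ} (hΦ : ConvexOn ℝ univ Φ) :
    ∃ a b : ℝ, 0 ≤ a ∧ ∀ u, -(a * ‖u‖) - b ≤ Φ u := by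
  have hc : Continuous Φ := hΦ.locallyLipschitz.continuous
  obtain ⟨R, hR⟩ := (isCompact_closedBall (0 : E) 1).bddAbove_image hc.continuousOn
  have hR' : ∀ v : E, ‖v‖ ≤ 1 → Φ v ≤ R := fun v hv =>
    hR (mem_image_of_mem _ (by simpa using hv))
  refine ⟨R - Φ 0, R - 2 * Φ 0, sub_nonneg.2 (hR' 0 (by simp)), fun u => ?_⟩
  have hn := norm_nonneg u
  have h1 : (0 : ℝ) < 1 + ‖u‖ := by positivity
  have h2 : (0 : ℝ) < 2 + ‖u‖ := by positivity
  -- Scaling by `1 + ‖u‖` rather than `‖u‖` covers `u = 0` as well.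
  have hv : ‖-((1 + ‖u‖)⁻¹ • u)‖ ≤ 1 := by
    rw [norm_neg, norm_smul, norm_inv, Real.norm_of_nonneg h1.le, inv_mul_le_iff₀ h1]
    linarith
  have h := hΦ.2 (mem_univ u) (mem_univ (-((1 + ‖u‖)⁻¹ • u)))
    (by positivity : 0 ≤ 1 / (2 + ‖u‖)) (by positivity : 0 ≤ (1 + ‖u‖) / (2 + ‖u‖))
    (by field_simp; ring)
  have e : (1 / (2 + ‖u‖)) • u + ((1 + ‖u‖) / (2 + ‖u‖)) • -((1 + ‖u‖)⁻¹ • u) = 0 := by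
    rw [smul_neg, smul_smul, ← sub_eq_add_neg, ← sub_smul]
    have : 1 / (2 + ‖u‖) - (1 + ‖u‖) / (2 + ‖u‖) * (1 + ‖u‖)⁻¹ = 0 := by field_simp; ring
    rw [this, zero_smul]
  rw [e, smul_eq_mul, smul_eq_mul] at h
  have h3 := mul_le_mul_of_nonneg_left (hR' _ hv) (by positivity : 0 ≤ (1 + ‖u‖) / (2 + ‖u‖))
  have h4 : Φ 0 ≤ (Φ u + (1 + ‖u‖) * R) / (2 + ‖u‖) := by
    calc _ ≤ _ := h.trans (add_le_add_right h3 _)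
      _ = _ := by field_simp
  rw [le_div_iff₀ h2] at h4
  nlinarith

variable {p : ℝ}

/-- The cone of the `g ∈ L_p[0,1]` with the sign pattern prescribed by the change points `x`. -/
def signCone (p : ℝ) {K : ℕ} (x : Fin K → ℝ) : Set (Lp ℝ (ENNReal.ofReal p) μ01) :=
  {g | ∀ k : Fin (K + 1), ∀ᵐ t ∂μ01,
    t ∈ Icc (knot x k.castSucc) (knot x k.succ) → 0 ≤ (-1 : ℝ) ^ (k : ℕ) * g t}

theorem zero_mem_signCone {K : ℕ} (x : Fin K → ℝ) : 0 ∈ signCone p x := fun k => by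
  filter_upwards [Lp.coeFn_zero ℝ (ENNReal.ofReal p) μ01] with t ht _
  rw [ht, Pi.zero_apply, mul_zero]

theorem half_add_mem_signCone {K : ℕ} {x : Fin K → ℝ} {g h : Lp ℝ (ENNReal.ofReal p) μ01}
    (hg : g ∈ signCone p x) (hh : h ∈ signCone p x) : (1 / 2 : ℝ) • (g + h) ∈ signCone p x :=
  fun k => by
  filter_upwards [Lp.coeFn_smul (1 / 2 : ℝ) (g + h), Lp.coeFn_add g h, hg k, hh k]
    with t h1 h2 h3 h4 ht
  simp only [h1, h2, Pi.smul_apply, Pi.add_apply, smul_eq_mul]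
  linarith [h3 ht, h4 ht]

/-- Here `h` is `g` cut off to `E`: the removed part, small in support. The retained part is `g -
h`. -/
theorem exists_truncation (E : Set ℝ) (hE : MeasurableSet E)
    (g : Lp ℝ (ENNReal.ofReal p) μ01) : ∃ h : Lp ℝ (ENNReal.ofReal p) μ01,
      ‖h‖ ≤ ‖g‖ ∧ ‖g - h‖ ≤ ‖g‖ ∧ (∀ᵐ t ∂μ01, t ∈ E → (g - h) t = 0) ∧
      (∀ᵐ t ∂μ01, t ∉ E → h t = 0 ∧ (g - h) t = g t) := by
  have hm := (Lp.memLp g).indicator hE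
  have ha := hm.coeFn_toLp
  have hs := Lp.coeFn_sub g (hm.toLp _)
  refine ⟨hm.toLp _, Lp.norm_le_norm_of_ae_le ?_, Lp.norm_le_norm_of_ae_le ?_, ?_, ?_⟩
  · filter_upwards [ha] with t h1
    rw [h1]; exact norm_indicator_le_norm_self _ _
  · filter_upwards [ha, hs] with t h1 h2
    rw [h2, Pi.sub_apply, h1]
    by_cases h : t ∈ E <;> simp [h]
  · filter_upwards [ha, hs] with t h1 h2 h
    rw [h2, Pi.sub_apply, h1]; simp [h]
  · filter_upwards [ha, hs] with t h1 h2 h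
    rw [h2, Pi.sub_apply, h1]; simp [h]

/-- Outside the mismatch set, a point of the `k`-th interval for `x` also lies in the `k`-th
interval for `x'`, so the sign is inherited; on it the value `0` has every sign. -/
theorem mem_signCone_of_truncation {K : ℕ} {x x' : Fin K → ℝ}
    {g g' : Lp ℝ (ENNReal.ofReal p) μ01} (hg : g ∈ signCone p x')
    (h0 : ∀ᵐ t ∂μ01, t ∈ mismatch x x' → g' t = 0)
    (h1 : ∀ᵐ t ∂μ01, t ∉ mismatch x x' → g' t = g t) : g' ∈ signCone p x := fun k => by
  filter_upwards [h0, h1, hg k] with t h0 h1 h2 ht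
  by_cases h : t ∈ mismatch x x'
  · simp [h0 h]
  · rw [h1 h]
    refine h2 (by_contra fun h' => h (mem_iUnion.2 ⟨k, ht, h'⟩))

/-- Convergence in `L_p` gives almost everywhere convergence along a subsequence, which preserves
signs. -/
theorem isSeqClosed_signCone [Fact (1 ≤ ENNReal.ofReal p)] {K : ℕ} (x : Fin K → ℝ) :
    IsSeqClosed (signCone p x) := fun g g₀ hg hlim k => by
  obtain ⟨φ, -, hφ⟩ := (tendstoInMeasure_of_tendsto_Lp hlim).exists_seq_tendsto_ae
  filter_upwards [ae_all_iff.2 fun n => hg n k, hφ] with t h1 h2 ht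
  exact ge_of_tendsto' (h2.const_mul _) fun n => h1 _ ht

/-- Minimization of `c ‖g‖^p + Φ (A g)` over all sign cones at once. -/
theorem exists_minimizer_signCone [Fact (1 ≤ ENNReal.ofReal p)] (hp : 1 < p) {c : ℝ} (hc : 0 < c)
    {N : ℕ} (A : Lp ℝ (ENNReal.ofReal p) μ01 →L[ℝ] (Fin N → ℝ)) {Φ : (Fin N → ℝ) → ℝ}
    (hΦ : ConvexOn ℝ univ Φ) (K : ℕ) :
    ∃ x ∈ ChangePoints K, ∃ g ∈ signCone p x, ∀ x' ∈ ChangePoints K, ∀ g' ∈ signCone p x',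
      c * ‖g‖ ^ p + Φ (A g) ≤ c * ‖g'‖ ^ p + Φ (A g') := by
  have p0 : 0 < p := by linarith
  have hΦc : Continuous Φ := hΦ.locallyLipschitz.continuous
  set J : Lp ℝ (ENNReal.ofReal p) μ01 → ℝ := fun g => c * ‖g‖ ^ p + Φ (A g) with hJ
  have hJc : Continuous J := by
    have := (Real.continuous_rpow_const p0.le).comp
      (continuous_norm (E := Lp ℝ (ENNReal.ofReal p) μ01))
    exact (this.const_mul c).add (hΦc.comp A.continuous)
  -- Coercivity: `Φ (A g)` falls at most linearly, with slope `a * ‖A‖`, and `c ‖g‖^p` absorbs this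
  -- slope plus one.
  obtain ⟨D, hD⟩ : ∃ D, ∀ g, ‖g‖ ≤ J g + D := by
    obtain ⟨a, b, ha, hab⟩ := exists_affine_le_of_convexOn hΦ
    obtain ⟨B, hB⟩ := exists_linear_le_rpow hp hc (by positivity : 0 ≤ a * ‖A‖ + 1)
    refine ⟨B + b, fun g => ?_⟩
    have h1 := hB ‖g‖ (norm_nonneg g)
    have h2 := hab (A g)
    have h3 := mul_le_mul_of_nonneg_left (A.le_opNorm g) ha
    simp only [hJ]; linarith
  let S : Set ℝ := {r | ∃ x ∈ ChangePoints K, ∃ g ∈ signCone p x, J g = r}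
  have hSne : S.Nonempty := ⟨J 0, 0, ⟨monotone_const, fun k => by simp⟩, 0,
    zero_mem_signCone 0, rfl⟩
  have hSb : BddBelow S := by
    refine ⟨-D, ?_⟩
    rintro _ ⟨x, -, g, -, rfl⟩
    linarith [hD g, norm_nonneg g]
  have hlow : ∀ x ∈ ChangePoints K, ∀ g ∈ signCone p x, sInf S ≤ J g := fun x hx g hg =>
    csInf_le hSb ⟨x, hx, g, hg, rfl⟩
  obtain ⟨r, -, hr, hrS⟩ := exists_seq_tendsto_sInf hSne hSb
  choose u hu v hv huv using hrS
  obtain ⟨x, hx, φ, hφ, hφx⟩ := (isCompact_changePoints K).tendsto_subseq hu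
  have hJv : Tendsto (fun n => J (v (φ n))) atTop (𝓝 (sInf S)) := by
    simp only [huv]; exact hr.comp hφ.tendsto_atTop
  obtain ⟨R, hR⟩ := hJv.bddAbove_range
  have hvM : ∀ n, ‖v (φ n)‖ ≤ R + D := fun n =>
    (hD _).trans (add_le_add_left (hR (mem_range_self n)) _)
  choose h h1 h2 h3 h4 using fun n => exists_truncation (mismatch x (u (φ n)))
    (measurableSet_mismatch _ _) (v (φ n))
  set g : ℕ → Lp ℝ (ENNReal.ofReal p) μ01 := fun n => v (φ n) - h n with hg
  have hgS : ∀ n, g n ∈ signCone p x := fun n => mem_signCone_of_truncation (hv (φ n)) (h3 n)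
    ((h4 n).mono fun t ht h' => (ht h').2)
  have hgM : ∀ n, ‖g n‖ ≤ R + D := fun n => (h2 n).trans (hvM n)
  have hAh : Tendsto (fun n => A (h n)) atTop (𝓝 0) := by
    rw [tendsto_pi_nhds]
    exact fun i => tendsto_apply_of_small_support hp ((ContinuousLinearMap.proj i).comp A)
      (fun n => measurableSet_mismatch _ _) (tendsto_measure_mismatch hφx)
      (fun n => (h4 n).mono fun t ht h' => (ht h').1) fun n => (h1 n).trans (hvM n)
  -- Both observation vectors stay in a fixed closed ball, where `Φ` is uniformly continuous; their
  -- difference is `A (h n)`.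
  have hdiff : Tendsto (fun n => Φ (A (g n)) - Φ (A (v (φ n)))) atTop (𝓝 0) := by
    have huc := (isCompact_closedBall (0 : Fin N → ℝ)
      (‖A‖ * (R + D))).uniformContinuousOn_of_continuous hΦc.continuousOn
    have hball : ∀ w : Lp ℝ (ENNReal.ofReal p) μ01, ‖w‖ ≤ R + D →
        A w ∈ Metric.closedBall 0 (‖A‖ * (R + D)) := fun w hw => by
      rw [mem_closedBall_zero_iff]
      exact (A.le_opNorm w).trans (mul_le_mul_of_nonneg_left hw (norm_nonneg A))
    rw [Metric.uniformContinuousOn_iff] at huc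
    rw [Metric.tendsto_nhds] at hAh ⊢
    intro ε hε
    obtain ⟨δ, hδ, H⟩ := huc ε hε
    filter_upwards [hAh δ hδ] with n hn
    have := H _ (hball _ (hgM n)) _ (hball _ (hvM n)) (by
      rw [dist_eq_norm, hg]
      simpa using hn)
    simpa [dist_eq_norm] using this
  have hJg : Tendsto (fun n => J (g n)) atTop (𝓝 (sInf S)) := by
    refine tendsto_of_tendsto_of_tendsto_of_le_of_le tendsto_const_nhds
      (by simpa using hJv.add hdiff) (fun n => hlow x hx _ (hgS n)) fun n => ?_
    have : c * ‖g n‖ ^ p ≤ c * ‖v (φ n)‖ ^ p :=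
      mul_le_mul_of_nonneg_left (Real.rpow_le_rpow (norm_nonneg _) (h2 n) p0.le) hc.le
    simp only [hJ]; linarith
  have hcau : CauchySeq g := by
    refine cauchySeq_of_minimizing hp hc (Ψ := fun w => Φ (A w)) (fun w z => ?_)
      (fun w hw z hz => half_add_mem_signCone hw hz) (hlow x hx) hgS hgM hJg
    have := hΦ.2 (mem_univ (A w)) (mem_univ (A z)) (by norm_num : (0 : ℝ) ≤ 1 / 2)
      (by norm_num : (0 : ℝ) ≤ 1 / 2) (by norm_num)
    simp only [smul_eq_mul] at this
    rw [map_smul, map_add, smul_add]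
    linarith
  obtain ⟨g₀, hg₀⟩ := cauchySeq_tendsto_of_complete hcau
  have hlim : J g₀ = sInf S := tendsto_nhds_unique ((hJc.tendsto g₀).comp hg₀) hJg
  exact ⟨x, hx, g₀, isSeqClosed_signCone x hgS hg₀, fun x' hx' g' hg' =>
    hlim.le.trans (hlow x' hx' g' hg')⟩

end

/-! ### Reduction of the Sobolev space to `L_p` and polynomials. -/

section

theorem exists_iterated_primitive {h : ℝ → ℝ} (hh : Continuous h) (m : ℕ) :
    ∃ f : ℝ → ℝ, ContDiff ℝ m f ∧ iteratedDeriv m f = h ∧ ∀ j < m, iteratedDeriv j f 0 = 0 := by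
  induction m with
  | zero => exact ⟨h, contDiff_zero.2 hh, by simp, by simp⟩
  | succ m ih =>
    obtain ⟨f, hf, hfm, hf0⟩ := ih
    have hd : deriv (fun t => ∫ s in (0 : ℝ)..t, f s) = f := by
      funext t; exact hf.continuous.deriv_integral f 0 t
    refine ⟨fun t => ∫ s in (0 : ℝ)..t, f s, ?_, ?_, fun j hj => ?_⟩
    · rw [Nat.cast_add, Nat.cast_one, contDiff_succ_iff_deriv, hd]
      exact ⟨intervalIntegral.differentiable_integral_of_continuous hf.continuous, by simp, hf⟩
    · rw [iteratedDeriv_succ', hd, hfm]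
    · cases j with
      | zero => simp
      | succ j => rw [iteratedDeriv_succ', hd]; exact hf0 j (by omega)

theorem D_eq_iteratedDeriv {j : ℕ} {f : ℝ → ℝ} (hf : ContDiff ℝ j f) {t : ℝ}
    (ht : t ∈ Icc (0 : ℝ) 1) : D j f t = iteratedDeriv j f t :=
  iteratedDerivWithin_eq_iteratedDeriv (uniqueDiffOn_Icc zero_lt_one) hf.contDiffAt ht

variable {p : ℝ} {m : ℕ}

instance : IsFiniteMeasure μ01 := by unfold μ01; infer_instance

/-- Every `g ∈ L_p[0,1]` is the `m`-th derivative of an element of `W_{m,p}[0,1]`. -/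
theorem exists_mem_W_D_eq (hp : 1 < p) (m : ℕ) {g : ℝ → ℝ}
    (hg : MemLp g (ENNReal.ofReal p) μ01) :
    ∃ f ∈ W m p, D m f =ᵐ[μ01] g ∧ ∀ j < m, D j f 0 = 0 := by
  cases m with
  | zero =>
    have hD : D 0 g = g := by funext t; simp [D]
    exact ⟨g, ⟨by simp, by rwa [hD]⟩, by rw [hD], by simp⟩
  | succ n =>
    have h0 : (0 : ℝ) ∈ Icc (0 : ℝ) 1 := by simp
    have hgi : IntegrableOn g (Icc 0 1) volume :=
      hg.integrable (by rw [← ENNReal.ofReal_one]; exact ENNReal.ofReal_le_ofReal hp.le)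
    have hG : Integrable ((Icc (0 : ℝ) 1).indicator g) volume :=
      (integrable_indicator_iff measurableSet_Icc).2 hgi
    -- Only this first integration needs Lebesgue differentiation. Extending `g` by zero makes `h`
    -- continuous on all of `ℝ`, so the other `n` integrations are classical.
    set h : ℝ → ℝ := fun t => ∫ s in (0 : ℝ)..t, (Icc (0 : ℝ) 1).indicator g s with hh
    have hc : Continuous h :=
      intervalIntegral.continuous_primitive (fun a b => hG.intervalIntegrable) 0
    have hac : AbsolutelyContinuousOnInterval h 0 1 :=
      hG.intervalIntegrable.absolutelyContinuousOnInterval_intervalIntegral (by simp)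
    obtain ⟨f, hf, hfn, hf0⟩ := exists_iterated_primitive hc n
    have hle : ∀ j, j ≤ n → ContDiff ℝ j f := fun j hj => hf.of_le (by exact_mod_cast hj)
    have hDn : EqOn (D n f) h (Icc 0 1) := fun t ht => by
      rw [D_eq_iteratedDeriv hf ht, hfn]
    have hDg : D (n + 1) f =ᵐ[μ01] g := by
      have e1 : ∀ᵐ t ∂μ01, t ∈ Icc (0 : ℝ) 1 := ae_restrict_mem measurableSet_Icc
      have e2 : ∀ᵐ t ∂μ01, ∀ c, HasDerivAt
          (fun x => ∫ s in c..x, (Icc (0 : ℝ) 1).indicator g s)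
            ((Icc (0 : ℝ) 1).indicator g t) t :=
        ae_restrict_of_ae (LocallyIntegrable.ae_hasDerivAt_integral hG.locallyIntegrable)
      filter_upwards [e1, e2] with t ht hd
      have : D (n + 1) f t = derivWithin (D n f) (Icc 0 1) t := by
        simp only [D, iteratedDerivWithin_succ]
      rw [this, derivWithin_congr hDn (hDn ht),
        (hd 0).hasDerivWithinAt.derivWithin (uniqueDiffOn_Icc zero_lt_one t ht),
        indicator_of_mem ht]
    refine ⟨f, ⟨fun j hj => ⟨(hle j (by omega)).contDiffOn, ?_⟩, ?_⟩, hDg, fun j hj => ?_⟩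
    · rcases Nat.lt_succ_iff_lt_or_eq.1 hj with hj' | rfl
      · have h1 : ContDiff ℝ 1 (iteratedDeriv j f) :=
          (contDiff_nat_succ_iff_contDiff_one_iteratedDeriv.1 (hle (j + 1) hj')).2
        exact absolutelyContinuousOnInterval_congr
          (fun t ht => (D_eq_iteratedDeriv (hle j hj'.le) ht).symm)
          h1.contDiffOn.absolutelyContinuousOnInterval
      · exact absolutelyContinuousOnInterval_congr hDn.symm hac
    · exact (memLp_congr_ae hDg).2 hg
    · rcases Nat.lt_succ_iff_lt_or_eq.1 hj with hj' | rfl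
      · rw [D_eq_iteratedDeriv (hle j hj'.le) h0, hf0 j hj']
      · rw [hDn h0]; simp [hh]

theorem D_eval (j : ℕ) (q : Polynomial ℝ) {t : ℝ} (ht : t ∈ Icc (0 : ℝ) 1) :
    D j (fun t => q.eval t) t = (Polynomial.derivative^[j] q).eval t := by
  have hq : ContDiff ℝ j fun t => q.eval t := by
    simpa using Polynomial.contDiff_aeval (𝕜 := ℝ) q (j : WithTop ℕ∞)
  rw [D_eq_iteratedDeriv hq ht]
  clear hq
  induction j generalizing q with
  | zero => simp
  | succ j ih =>
    have : deriv (fun t => q.eval t) = fun t => q.derivative.eval t := by funext t; simp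
    rw [iteratedDeriv_succ', this, ih, Function.iterate_succ_apply]

/-- There is a polynomial of degree less than `m` with prescribed derivatives at `0`. -/
theorem exists_polynomial_D_eq (m : ℕ) (c : ℕ → ℝ) :
    ∃ q : Polynomial ℝ, q.degree < m ∧ ∀ j < m, D j (fun t => q.eval t) 0 = c j := by
  refine ⟨∑ j ∈ Finset.range m, Polynomial.C (c j / j.factorial) * Polynomial.X ^ j, ?_, ?_⟩
  · refine (Polynomial.degree_sum_le _ _).trans_lt ?_
    refine (Finset.sup_lt_iff (WithBot.bot_lt_coe m)).2 fun j hj => ?_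
    exact (Polynomial.degree_C_mul_X_pow_le _ _).trans_lt
      (WithBot.coe_lt_coe.2 (Finset.mem_range.1 hj))
  · intro j hj
    rw [D_eval j _ (by simp), ← Polynomial.coeff_zero_eq_eval_zero,
      Polynomial.coeff_iterate_derivative, Polynomial.finsetSum_coeff]
    have : (j.factorial : ℝ) ≠ 0 := by positivity
    simp only [zero_add, Polynomial.coeff_C_mul, Polynomial.coeff_X_pow]
    rw [Finset.sum_eq_single j (by intro i _ hi; simp [hi.symm])
      (fun h => absurd (Finset.mem_range.2 hj) h)]
    rw [Nat.descFactorial_self]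
    simp only [if_true, mul_one, nsmul_eq_mul]
    field_simp

theorem D_eval_eq_zero {q : Polynomial ℝ} (hq : q.degree < m) {t : ℝ}
    (ht : t ∈ Icc (0 : ℝ) 1) : D m (fun t => q.eval t) t = 0 := by
  rw [D_eval m q ht, Polynomial.iterate_derivative_eq_zero_of_degree_lt hq, Polynomial.eval_zero]

theorem D_zero_add {j : ℕ} (hj : j < m) (f g : W m p) :
    D j (f + g : W m p) 0 = D j f 0 + D j g 0 :=
  D_add (f.2.1 j hj).1 (g.2.1 j hj).1 (by simp)

theorem D_zero_smul {j : ℕ} (c : ℝ) (f : W m p) : D j (c • f : W m p) 0 = c * D j f 0 :=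
  congrFun (D_smul j c f) 0

theorem D_sub_zero {j : ℕ} (hj : j < m) (f g : W m p) :
    D j (f - g : W m p) 0 = D j f 0 - D j g 0 := by
  have : f - g = f + (-1 : ℝ) • g := by module
  rw [this, D_zero_add hj, D_zero_smul]; ring

theorem D_coe_add (f g : W m p) : D m (f + g : W m p) =ᵐ[μ01] D m f + D m g :=
  D_add_ae f.2 g.2

theorem D_coe_sub (f g : W m p) : D m (f - g : W m p) =ᵐ[μ01] D m f - D m g := by
  have h : f - g = f + (-1 : ℝ) • g := by module
  rw [h]
  refine (D_coe_add f _).trans ?_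
  have : D m ((-1 : ℝ) • g : W m p) = (-1 : ℝ) • D m g := D_smul m (-1) g
  rw [this]
  exact Eventually.of_forall fun t => by simp [sub_eq_add_neg]

theorem intervalIntegral_eq_integral_μ01 (u : ℝ → ℝ) :
    ∫ t in (0 : ℝ)..1, u t = ∫ t, u t ∂μ01 := by
  rw [intervalIntegral.integral_of_le zero_le_one, ← integral_Icc_eq_integral_Ioc]; rfl

/-- The `m`-th derivative of an element of the Sobolev space, as an element of `L_p[0,1]`. -/
def topDeriv (f : W m p) : Lp ℝ (ENNReal.ofReal p) μ01 := MemLp.toLp (D m f) f.2.2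

theorem coeFn_topDeriv (f : W m p) : topDeriv f =ᵐ[μ01] D m f := MemLp.coeFn_toLp _

theorem integral_D_rpow (hp : 1 < p) (f : W m p) :
    ∫ t in (0 : ℝ)..1, |D m f t| ^ p = ‖topDeriv f‖ ^ p := by
  rw [intervalIntegral_eq_integral_μ01, norm_Lp_rpow hp]
  refine integral_congr_ae ?_
  filter_upwards [coeFn_topDeriv f] with t ht
  rw [ht]

/-- All knots lie in `[0,1]`, so nothing is lost by passing from Lebesgue measure to its
restriction. -/
theorem mem_V_iff {K : ℕ} {x : Fin K → ℝ} (hx : x ∈ ChangePoints K) (f : W m p) :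
    f ∈ V m p x ↔ topDeriv f ∈ signCone p x := by
  refine forall_congr' fun k => ?_
  have hsub : Icc (knot x k.castSucc) (knot x k.succ) ⊆ Icc 0 1 := fun t ht =>
    ⟨(knot_mem_Icc hx _).1.trans ht.1, ht.2.trans (knot_mem_Icc hx _).2⟩
  constructor
  · intro h
    filter_upwards [ae_restrict_of_ae h, coeFn_topDeriv f] with t h1 h2 ht
    rw [h2]; exact h1 ht
  · intro h
    have : ∀ᵐ t ∂μ01, t ∈ Icc (knot x k.castSucc) (knot x k.succ) →
        0 ≤ (-1 : ℝ) ^ (k : ℕ) * D m f t := by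
      filter_upwards [h, coeFn_topDeriv f] with t h1 h2 ht
      rw [← h2]; exact h1 ht
    filter_upwards [(ae_restrict_iff' measurableSet_Icc).1 this] with t h1 ht
    exact h1 (hsub ht) ht

/-- Polynomials of degree less than `m` as elements of the Sobolev space. -/
def polynomialW (m : ℕ) (p : ℝ) : Polynomial.degreeLT ℝ m →ₗ[ℝ] W m p where
  toFun q := ⟨fun t => (q : Polynomial ℝ).eval t, polynomial_mem_W m p q⟩
  map_add' q r := by ext t; simp
  map_smul' c q := by ext t; simp

theorem D_polynomialW (q : Polynomial.degreeLT ℝ m) : D m (polynomialW m p q) =ᵐ[μ01] 0 := by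
  have e1 : ∀ᵐ t ∂μ01, t ∈ Icc (0 : ℝ) 1 := ae_restrict_mem measurableSet_Icc
  filter_upwards [e1] with t ht
  exact D_eval_eq_zero (Polynomial.mem_degreeLT.1 q.2) ht

theorem topDeriv_add_polynomialW (f : W m p) (q : Polynomial.degreeLT ℝ m) :
    topDeriv (f + polynomialW m p q) = topDeriv f := by
  refine Lp.ext ?_
  filter_upwards [coeFn_topDeriv (f + polynomialW m p q), coeFn_topDeriv f,
    D_coe_add f (polynomialW m p q), D_polynomialW (p := p) q] with t h1 h2 h3 h4
  rw [h1, h2, h3, Pi.add_apply, h4]; simp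

/-- A choice of an `m`-fold primitive with vanishing initial values. -/
def primitive (hp : 1 < p) (m : ℕ) (g : Lp ℝ (ENNReal.ofReal p) μ01) : W m p :=
  ⟨(exists_mem_W_D_eq hp m (Lp.memLp g)).choose,
    (exists_mem_W_D_eq hp m (Lp.memLp g)).choose_spec.1⟩

theorem D_primitive (hp : 1 < p) (g : Lp ℝ (ENNReal.ofReal p) μ01) :
    D m (primitive hp m g) =ᵐ[μ01] g :=
  (exists_mem_W_D_eq hp m (Lp.memLp g)).choose_spec.2.1

theorem D_primitive_zero (hp : 1 < p) (g : Lp ℝ (ENNReal.ofReal p) μ01) {j : ℕ} (hj : j < m) :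
    D j (primitive hp m g) 0 = 0 :=
  (exists_mem_W_D_eq hp m (Lp.memLp g)).choose_spec.2.2 j hj

theorem topDeriv_primitive (hp : 1 < p) (g : Lp ℝ (ENNReal.ofReal p) μ01) :
    topDeriv (primitive hp m g) = g :=
  Lp.ext ((coeFn_topDeriv _).trans (D_primitive hp g))

variable [Fact (1 ≤ ENNReal.ofReal p)]

theorem normW_eq_norm_topDeriv (hp : 1 < p) {f : W m p} (h0 : ∀ j < m, D j f 0 = 0) :
    normW m p f = ‖topDeriv f‖ := by
  have p0 : 0 < p := by linarith
  rw [normW, integral_D_rpow hp, Finset.sum_eq_zero, zero_add, ← Real.rpow_mul (norm_nonneg _),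
    mul_one_div_cancel p0.ne', Real.rpow_one]
  intro j hj
  rw [h0 j (Finset.mem_range.1 hj), abs_zero, Real.zero_rpow p0.ne']

/-- Elements of `W m p` are functions on `ℝ`, so `normW` can vanish on nonzero elements, but a
bounded functional kills these. Hence `L ∘ primitive` is linear although `primitive` is an arbitrary
choice, and Taylor's formula holds after applying `L`. -/
theorem IsBoundedFunctional.eq_zero (hp : 1 < p) {L : W m p →ₗ[ℝ] ℝ} (hL : IsBoundedFunctional L)
    {f : W m p} (h0 : ∀ j < m, D j f 0 = 0) (hm : D m f =ᵐ[μ01] 0) : L f = 0 := by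
  obtain ⟨C, hC⟩ := hL
  have h := hC f
  have hz : topDeriv f = 0 := by
    rw [Lp.eq_zero_iff_ae_eq_zero]
    exact (coeFn_topDeriv f).trans hm
  rw [normW_eq_norm_topDeriv hp h0, hz, norm_zero, mul_zero] at h
  exact abs_nonpos_iff.1 h

/-- The functional on `L_p[0,1]` induced by a bounded functional on the Sobolev space. -/
def inducedFunctional (hp : 1 < p) {L : W m p →ₗ[ℝ] ℝ} (hL : IsBoundedFunctional L) :
    Lp ℝ (ENNReal.ofReal p) μ01 →L[ℝ] ℝ :=
  LinearMap.mkContinuousOfExistsBound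
    { toFun := fun g => L (primitive hp m g)
      map_add' := fun g h => by
        rw [← map_add, ← sub_eq_zero, ← map_sub]
        refine hL.eq_zero hp (fun j hj => ?_) ?_
        · rw [D_sub_zero hj, D_zero_add hj]
          simp only [D_primitive_zero hp _ hj]; ring
        · filter_upwards [D_coe_sub (primitive hp m (g + h)) (primitive hp m g + primitive hp m h),
            D_coe_add (primitive hp m g) (primitive hp m h), D_primitive (m := m) hp g,
            D_primitive (m := m) hp h, D_primitive (m := m) hp (g + h), Lp.coeFn_add g h]
            with t h1 h2 h3 h4 h5 h6
          rw [h1, Pi.sub_apply, h2, Pi.add_apply, h3, h4, h5, h6]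
          simp
      map_smul' := fun c g => by
        rw [RingHom.id_apply, ← map_smul, ← sub_eq_zero, ← map_sub]
        refine hL.eq_zero hp (fun j hj => ?_) ?_
        · rw [D_sub_zero hj, D_zero_smul]
          simp only [D_primitive_zero hp _ hj]; ring
        · have hs : D m (c • primitive hp m g : W m p) = c • D m (primitive hp m g) := D_smul m c _
          filter_upwards [D_coe_sub (primitive hp m (c • g)) (c • primitive hp m g),
            D_primitive (m := m) hp g, D_primitive (m := m) hp (c • g), Lp.coeFn_smul c g]
            with t h1 h2 h3 h4
          rw [h1, Pi.sub_apply, hs, Pi.smul_apply, h2, h3, h4]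
          simp }
    (by
      obtain ⟨C, hC⟩ := hL
      refine ⟨C, fun g => ?_⟩
      have := hC (primitive hp m g)
      rwa [normW_eq_norm_topDeriv hp fun j hj => D_primitive_zero hp g hj,
        topDeriv_primitive] at this)

theorem inducedFunctional_apply (hp : 1 < p) {L : W m p →ₗ[ℝ] ℝ} (hL : IsBoundedFunctional L)
    (g : Lp ℝ (ENNReal.ofReal p) μ01) : inducedFunctional hp hL g = L (primitive hp m g) := rfl

/-- An element of the Sobolev space is the sum of its Taylor polynomial and the primitive of its
`m`-th derivative, as far as bounded functionals are concerned. -/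
theorem exists_polynomialW_functional_eq (hp : 1 < p) (f : W m p) :
    ∃ q : Polynomial.degreeLT ℝ m, ∀ (L : W m p →ₗ[ℝ] ℝ) (hL : IsBoundedFunctional L),
      L f = inducedFunctional hp hL (topDeriv f) + L (polynomialW m p q) := by
  obtain ⟨q, hq, hqj⟩ := exists_polynomial_D_eq m fun j => D j f 0
  refine ⟨⟨q, Polynomial.mem_degreeLT.2 hq⟩, fun L hL => ?_⟩
  rw [inducedFunctional_apply, ← map_add, ← sub_eq_zero, ← map_sub]
  set r := polynomialW m p ⟨q, Polynomial.mem_degreeLT.2 hq⟩ with hr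
  have hr0 : ∀ j < m, D j r 0 = D j f 0 := hqj
  refine hL.eq_zero hp (fun j hj => ?_) ?_
  · rw [D_sub_zero hj, D_zero_add hj, D_primitive_zero hp _ hj, hr0 j hj]; ring
  · filter_upwards [D_coe_sub f (primitive hp m (topDeriv f) + r),
      D_coe_add (primitive hp m (topDeriv f)) r, D_primitive (m := m) hp (topDeriv f),
      D_polynomialW (p := p) ⟨q, Polynomial.mem_degreeLT.2 hq⟩, coeFn_topDeriv f]
      with t h1 h2 h3 h4 h5
    rw [h1, Pi.sub_apply, h2, Pi.add_apply, h3, h4, h5]; simp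

end

/-! ### The data fit and the elimination of the polynomial part. -/

section

variable {N m : ℕ} {p : ℝ}

/-- The data fit `∑ ρ_i (u_i - y_i)` as a function of the vector `u` of observations. -/
def dataFit (ρ : Fin N → ℝ → ℝ) (y u : Fin N → ℝ) : ℝ := ∑ i, ρ i (u i - y i)

theorem convexOn_dataFit {ρ : Fin N → ℝ → ℝ} (hρ : ∀ i, ConvexOn ℝ univ (ρ i)) (y : Fin N → ℝ) :
    ConvexOn ℝ univ (dataFit ρ y) := by
  refine ⟨convex_univ, fun u _ v _ a b ha hb hab => ?_⟩
  simp only [dataFit, smul_eq_mul, Finset.mul_sum]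
  rw [← Finset.sum_add_distrib]
  refine Finset.sum_le_sum fun i _ => ?_
  have := (hρ i).2 (mem_univ (u i - y i)) (mem_univ (v i - y i)) ha hb hab
  simp only [smul_eq_mul] at this
  convert this using 2
  simp only [Pi.add_apply, Pi.smul_apply, smul_eq_mul]
  linear_combination y i * hab

theorem continuous_dataFit {ρ : Fin N → ℝ → ℝ} (hρ : ∀ i, Continuous (ρ i)) (y : Fin N → ℝ) :
    Continuous (dataFit ρ y) :=
  continuous_finsetSum _ fun i _ => (hρ i).comp (by fun_prop)

/-- Leaving every compact set of `ℝ^N` means that some coordinate does so; its term blows up while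
each other term is at least its minimum. -/
theorem tendsto_dataFit {ρ : Fin N → ℝ → ℝ} (hρ : ∀ i, Continuous (ρ i))
    (hlim : ∀ i, Tendsto (ρ i) (cocompact ℝ) atTop) (y : Fin N → ℝ) :
    Tendsto (dataFit ρ y) (cocompact (Fin N → ℝ)) atTop := by
  choose z hz using fun i => (hρ i).exists_forall_le (hlim i)
  rw [← Filter.coprodᵢ_cocompact, tendsto_atTop]
  intro R
  refine Filter.mem_coprodᵢ_iff.2 fun i => ?_
  have h : Tendsto (fun s => ρ i (s - y i)) (cocompact ℝ) atTop :=
    (hlim i).comp (Homeomorph.subRight (y i)).isClosedEmbedding.tendsto_cocompact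
  refine ⟨_, tendsto_atTop.1 h (R - ∑ k ∈ Finset.univ.erase i, ρ k (z k)), fun u hu => ?_⟩
  have h1 : R - ∑ k ∈ Finset.univ.erase i, ρ k (z k) ≤ ρ i (u i - y i) := hu
  have h2 : ∑ k ∈ Finset.univ.erase i, ρ k (z k) ≤
      ∑ k ∈ Finset.univ.erase i, ρ k (u k - y k) := Finset.sum_le_sum fun k _ => hz k _
  show R ≤ dataFit ρ y u
  rw [dataFit, ← Finset.add_sum_erase _ _ (Finset.mem_univ i)]
  linarith

section Quotient

variable {E : Type*} [AddCommGroup E] [Module ℝ E] {F : E → ℝ} (U : Submodule ℝ E)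

/-- The point `u + w / 2` is the midpoint of `v + w` and the fixed point `2u - v`, so a lower bound
on one translate of `U` carries over to all of them. -/
theorem bddBelow_translate_of_convexOn (hF : ConvexOn ℝ univ F) {u : E}
    (hu : BddBelow (range fun w : U => F (u + w))) (v : E) :
    BddBelow (range fun w : U => F (v + w)) := by
  obtain ⟨b, hb⟩ := hu
  refine ⟨2 * b - F (2 • u - v), ?_⟩
  rintro _ ⟨w, rfl⟩
  have h1 : b ≤ F (u + ((1 / 2 : ℝ) • w : U)) := hb (mem_range_self _)
  have h2 := hF.2 (mem_univ (v + w)) (mem_univ (2 • u - v)) (by norm_num : (0 : ℝ) ≤ 1 / 2)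
    (by norm_num : (0 : ℝ) ≤ 1 / 2) (by norm_num)
  have e : (1 / 2 : ℝ) • (v + (w : E)) + (1 / 2 : ℝ) • (2 • u - v) =
      u + ((1 / 2 : ℝ) • w : U) := by
    rw [Submodule.coe_smul]; module
  rw [e] at h2
  simp only [smul_eq_mul] at h2
  show _ ≤ F (v + w)
  linarith

/-- Convex combinations of near-optimal shifts in `U` are admissible shifts for the convex
combination of the base points. -/
theorem convexOn_iInf_translate (hF : ConvexOn ℝ univ F)
    (hb : ∀ u, BddBelow (range fun w : U => F (u + w))) :
    ConvexOn ℝ univ fun u => ⨅ w : U, F (u + w) := by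
  refine ⟨convex_univ, fun u _ v _ a b ha hb' hab => le_of_forall_pos_le_add fun ε hε => ?_⟩
  obtain ⟨w, hw⟩ := exists_lt_of_ciInf_lt
    (lt_add_of_pos_right (⨅ w : U, F (u + w)) hε)
  obtain ⟨z, hz⟩ := exists_lt_of_ciInf_lt
    (lt_add_of_pos_right (⨅ w : U, F (v + w)) hε)
  have h1 := ciInf_le (hb (a • u + b • v)) (a • w + b • z)
  have h2 := hF.2 (mem_univ (u + (w : E))) (mem_univ (v + (z : E))) ha hb' hab
  have e : a • (u + (w : E)) + b • (v + (z : E)) =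
      a • u + b • v + ((a • w + b • z : U) : E) := by
    rw [Submodule.coe_add, Submodule.coe_smul, Submodule.coe_smul]; module
  rw [e] at h2
  simp only [smul_eq_mul] at h2 ⊢
  have h3 := mul_le_mul_of_nonneg_left hw.le ha
  have h4 := mul_le_mul_of_nonneg_left hz.le hb'
  have h5 : a * ε + b * ε = ε := by rw [← add_mul, hab, one_mul]
  linarith

end Quotient

theorem VP_eq (hp : 1 < p) (lam : ℝ) (ρ : Fin N → ℝ → ℝ) (L : Fin N → W m p →ₗ[ℝ] ℝ)
    (y : Fin N → ℝ) (f : W m p) :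
    VP lam ρ L y f = lam / p * ‖topDeriv f‖ ^ p + dataFit ρ y (fun i => L i f) := by
  rw [VP, integral_D_rpow hp]; rfl

theorem optimalValue_le {lam : ℝ} {ρ : Fin N → ℝ → ℝ} {L : Fin N → W m p →ₗ[ℝ] ℝ}
    {y : Fin N → ℝ} {K : ℕ} {x : Fin K → ℝ} {f : W m p} (hf : f ∈ V m p x) :
    optimalValue lam ρ L y x ≤ (VP lam ρ L y f : EReal) :=
  iInf₂_le f hf

/-- The vectors of observations of the polynomials of degree less than `m`. -/
def polynomialObs (L : Fin N → W m p →ₗ[ℝ] ℝ) : Submodule ℝ (Fin N → ℝ) :=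
  LinearMap.range (LinearMap.pi fun i => (L i).comp (polynomialW m p))

end

end PiecewiseConvex

end

/-! ### The main theorem. -/

open PiecewiseConvex in
theorem mainTheorem3 (K m N : ℕ) (p lam : ℝ) (hp : 1 < p) (hlam : 0 < lam)
    (L : Fin N → PiecewiseConvex.W m p →ₗ[ℝ] ℝ)
    (hL : ∀ i, PiecewiseConvex.IsBoundedFunctional (L i))
    (ρ : Fin N → ℝ → ℝ) (hρ : ∀ i, Continuous (ρ i))
    (hρ' : ∀ i, StrictConvexOn ℝ Set.univ (ρ i)) (y : Fin N → ℝ) :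
    ∃ x ∈ PiecewiseConvex.ChangePoints K,
      IsMinOn (fun x' : Fin K → ℝ => PiecewiseConvex.optimalValue lam ρ L y x')
        (PiecewiseConvex.ChangePoints K) x ∧
      (PiecewiseConvex.SeparatesPolynomials L →
        (∀ i, Filter.Tendsto (ρ i) (Filter.cocompact ℝ) Filter.atTop) →
        ∃ f ∈ PiecewiseConvex.V m p x, ∀ x' ∈ PiecewiseConvex.ChangePoints K,
          ∀ g ∈ PiecewiseConvex.V m p x',
            PiecewiseConvex.VP lam ρ L y f ≤ PiecewiseConvex.VP lam ρ L y g) := by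
  have p0 : 0 < p := by linarith
  have : Fact (1 ≤ ENNReal.ofReal p) :=
    ⟨by rw [← ENNReal.ofReal_one]; exact ENNReal.ofReal_le_ofReal hp.le⟩
  have hF := convexOn_dataFit (fun i => (hρ' i).convexOn) y
  have hFc := continuous_dataFit hρ y
  set F := dataFit ρ y with hFdef
  set U := polynomialObs L with hU
  let A : Lp ℝ (ENNReal.ofReal p) μ01 →L[ℝ] (Fin N → ℝ) :=
    ContinuousLinearMap.pi fun i => inducedFunctional hp (hL i)
  -- Adding a polynomial realizes any shift `w` without touching the `m`-th derivative. With the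
  -- converse `hobs`, the problem becomes one in the pair `(g, w)`.
  have hreal : ∀ (x : Fin K → ℝ), x ∈ ChangePoints K → ∀ g ∈ signCone p x, ∀ w : U,
      ∃ f ∈ V m p x, VP lam ρ L y f = lam / p * ‖g‖ ^ p + F (A g + w) := by
    rintro x hx g hg ⟨_, q, rfl⟩
    have ht : topDeriv (primitive hp m g + polynomialW m p q) = g := by
      rw [topDeriv_add_polynomialW, topDeriv_primitive]
    refine ⟨primitive hp m g + polynomialW m p q, (mem_V_iff hx _).2 (by rwa [ht]), ?_⟩
    rw [VP_eq hp, ht]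
    congr 2
    funext i
    simp [A, inducedFunctional_apply]
  have hobs : ∀ f : W m p, ∃ w : U,
      VP lam ρ L y f = lam / p * ‖topDeriv f‖ ^ p + F (A (topDeriv f) + w) := by
    intro f
    obtain ⟨q, hq⟩ := exists_polynomialW_functional_eq hp f
    refine ⟨⟨_, q, rfl⟩, ?_⟩
    rw [VP_eq hp]
    congr 2
    funext i
    simp [A, hq (L i) (hL i)]
  by_cases hb : BddBelow (Set.range fun w : U => F (0 + w))
  · have hb' := bddBelow_translate_of_convexOn U hF hb
    obtain ⟨x, hx, g, hg, hmin⟩ := exists_minimizer_signCone hp (div_pos hlam p0) A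
      (convexOn_iInf_translate U hF hb') K
    have hlow : ∀ x' ∈ ChangePoints K, ∀ f ∈ V m p x',
        lam / p * ‖g‖ ^ p + ⨅ w : U, F (A g + w) ≤ VP lam ρ L y f := by
      intro x' hx' f hf
      obtain ⟨w, hw⟩ := hobs f
      have h1 := hmin x' hx' _ ((mem_V_iff hx' f).1 hf)
      have h2 := ciInf_le (hb' (A (topDeriv f))) w
      rw [hw]; linarith
    refine ⟨x, hx, fun x' hx' => ?_, fun _ hlim => ?_⟩
    · rw [Set.mem_ofPred_eq]
      refine le_iInf₂ (f := fun f (_ : f ∈ V m p x') => (VP lam ρ L y f : EReal)) fun f hf => ?_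
      -- The infimum over `U` need not be attained here, so a near-optimal `w` is compared with
      -- every real `z` above `VP[f]`.
      refine EReal.le_of_forall_lt_iff_le.1 fun z hz => ?_
      have hz' := EReal.coe_lt_coe_iff.1 hz
      have h1 := hlow x' hx' f hf
      obtain ⟨w, hw⟩ := exists_lt_of_ciInf_lt
        (show ⨅ w : U, F (A g + w) < z - lam / p * ‖g‖ ^ p by linarith)
      obtain ⟨f₁, hf₁, hVP⟩ := hreal x hx g hg w
      refine (optimalValue_le hf₁).trans (EReal.coe_le_coe_iff.2 ?_)
      rw [hVP]; linarith
    -- A translate of `U` is closed in `ℝ^N`, so `F` stays coercive along it and the infimum over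
    -- `w` is attained.
    · have hemb : Topology.IsClosedEmbedding fun w : U => A g + (w : Fin N → ℝ) :=
        (Homeomorph.addLeft (A g)).isClosedEmbedding.comp
          (Submodule.closed_of_finiteDimensional U).isClosedEmbedding_subtypeVal
      obtain ⟨w, hw⟩ := (hFc.comp hemb.continuous).exists_forall_le
        ((tendsto_dataFit hρ hlim y).comp hemb.tendsto_cocompact)
      obtain ⟨f, hf, hVP⟩ := hreal x hx g hg w
      refine ⟨f, hf, fun x' hx' f' hf' => ?_⟩
      have h1 : F (A g + w) ≤ ⨅ w : U, F (A g + w) := le_ciInf hw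
      have h2 := hlow x' hx' f' hf'
      rw [hVP]; linarith
  -- `F` is unbounded below on `U`: polynomials alone (`g = 0`) give the value `-∞`, so any change
  -- points would serve. Coercive `ρ_i` exclude this case.
  · have h0 : (0 : Fin K → ℝ) ∈ ChangePoints K := ⟨monotone_const, fun k => by simp⟩
    refine ⟨0, h0, fun x' _ => ?_, fun _ hlim => absurd ?_ hb⟩
    · suffices optimalValue lam ρ L y (0 : Fin K → ℝ) = ⊥ by
        simp only [Set.mem_ofPred_eq, this, bot_le]
      refine EReal.eq_bot_iff_forall_lt _ |>.2 fun z => ?_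
      obtain ⟨_, ⟨w, rfl⟩, hw⟩ := not_bddBelow_iff.1 hb z
      obtain ⟨f, hf, hVP⟩ := hreal 0 h0 0 (zero_mem_signCone 0) w
      refine (optimalValue_le hf).trans_lt (EReal.coe_lt_coe_iff.2 ?_)
      rw [hVP, norm_zero, Real.zero_rpow p0.ne', mul_zero, zero_add, map_zero]
      exact hw
    · obtain ⟨u, hu⟩ := hFc.exists_forall_le (tendsto_dataFit hρ hlim y)
      exact ⟨F u, by rintro _ ⟨w, rfl⟩; exact hu _⟩
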